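/- For a compact space $X$ let $G_X$ be the group of functions $X\to\mathbb Q$ that are continuous for the discrete topology on $\mathbb Q$, and let $(G_X)_{+,\ll}$ be the cone of those $g\in G_X$ such that $g=0$ or $g(x)>0$ for all $x\in X$. For a countable ordinal $\beta$ let $\mathcal G_{\beta+1}=(G_{\beta+1},(G_{\beta+1})_{+,\ll},1)$, where $\beta+1=\{\gamma\mid\gamma\le\beta\}$ carries the order topology and $1$ is the constant function. This is a unital ordered abelian group, regarded as a structure in the language $\{+,\le,u\}$, with $g\le h$ interpreted as $h-g\in(G_{\beta+1})_{+,\ll}$ and $u$ as $1$. For structures $M,N$ in the same language and an ordinal $\alpha$, write $M\equiv_\alpha N$ if $M$ and $N$ satisfy the same $\mathcal L_{\omega_1\omega}$-sentences of quantifier rank at most $\alpha$. Let $(\varepsilon_\alpha)_{\alpha<\omega_1}$ be the increasing enumeration of the countable ordinals $\varepsilon$ with $\omega^\varepsilon=\varepsilon$. Then each $\mathcal G_{\varepsilon_\alpha+1}$ with $\alpha<\omega_1$ is a simple dimension group, that is, it is countable, unperforated ($nx\ge 0$ for some $n>0$ implies $x\ge0$), has the Riesz interpolation property, and each of its nonzero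 positive elements is an order unit. Moreover, for all $\alpha<\beta<\omega_1$, the groups $\mathcal G_{\varepsilon_\alpha+1}$ and $\mathcal G_{\varepsilon_\beta+1}$ are not isomorphic as ordered abelian groups (hence not as unital ones either), and $$\mathcal G_{\varepsilon_\alpha+1}\equiv_{\varepsilon_\alpha}\mathcal G_{\varepsilon_\beta+1}.$$ -/

import Mathlib

open scoped Ordinal

/-! ### Infinitary logic with countable conjunctions and disjunctions -/

/-- Formulas of `𝓛_{ω₁ω}` over the first-order language `L`, with free variables indexed by
`Fin n`. The variable bound by a quantifier is the last one, of index `n`. -/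
inductive InfFormula (L : FirstOrder.Language.{0, 0}) : ℕ → Type
  | equal {n : ℕ} (t s : L.Term (Fin n)) : InfFormula L n
  | rel {n l : ℕ} (R : L.Relations l) (ts : Fin l → L.Term (Fin n)) : InfFormula L n
  | neg {n : ℕ} (φ : InfFormula L n) : InfFormula L n
  | conj {n : ℕ} (φ : ℕ → InfFormula L n) : InfFormula L n
  | disj {n : ℕ} (φ : ℕ → InfFormula L n) : InfFormula L n
  | ex {n : ℕ} (φ : InfFormula L (n + 1)) : InfFormula L n
  | all {n : ℕ} (φ : InfFormula L (n + 1)) : InfFormula L n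

/-- The quantifier rank of an `𝓛_{ω₁ω}`-formula. -/
noncomputable def InfFormula.qr {L : FirstOrder.Language.{0, 0}} :
    {n : ℕ} → InfFormula L n → Ordinal.{0}
  | _, .equal _ _ => 0
  | _, .rel _ _ => 0
  | _, .neg φ => φ.qr
  | _, .conj φ => ⨆ i, (φ i).qr
  | _, .disj φ => ⨆ i, (φ i).qr
  | _, .ex φ => φ.qr + 1
  | _, .all φ => φ.qr + 1

/-- Satisfaction of an `𝓛_{ω₁ω}`-formula in the `L`-structure `M` at the tuple `v`. -/
def InfFormula.Realize {L : FirstOrder.Language.{0, 0}} (M : Type*) [L.Structure M] :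
    {n : ℕ} → InfFormula L n → (Fin n → M) → Prop
  | _, .equal t s, v => t.realize v = s.realize v
  | _, .rel R ts, v => FirstOrder.Language.Structure.RelMap R fun i => (ts i).realize v
  | _, .neg φ, v => ¬ φ.Realize M v
  | _, .conj φ, v => ∀ i, (φ i).Realize M v
  | _, .disj φ, v => ∃ i, (φ i).Realize M v
  | _, .ex φ, v => ∃ a : M, φ.Realize M (Fin.snoc v a)
  | _, .all φ, v => ∀ a : M, φ.Realize M (Fin.snoc v a)

/-- `M ≡_α N`: the `L`-structures `M` and `N` agree on all `𝓛_{ω₁ω}`-sentences of quantifier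
rank at most `α`. -/
def InfEquiv (L : FirstOrder.Language.{0, 0}) (α : Ordinal.{0}) (M N : Type*)
    [L.Structure M] [L.Structure N] : Prop :=
  ∀ φ : InfFormula L 0, φ.qr ≤ α → (φ.Realize M Fin.elim0 ↔ φ.Realize N Fin.elim0)

/-! ### Unital ordered abelian groups -/

/-- A unital ordered abelian group `(G, G₊, u)`: an abelian group with a generating positive cone
`G₊` and an order unit `u`. The order is `g ≤ h ↔ h - g ∈ G₊`. -/
structure UnitalOrderedGroup where
  carrier : Type*
  [group : AddCommGroup carrier]
  pos : Set carrier
  unit : carrier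
  zero_mem : 0 ∈ pos
  add_mem : ∀ g ∈ pos, ∀ h ∈ pos, g + h ∈ pos
  exists_sub : ∀ g, ∃ a ∈ pos, ∃ b ∈ pos, g = a - b
  eq_zero : ∀ g ∈ pos, -g ∈ pos → g = 0
  unit_mem : unit ∈ pos
  unit_spec : ∀ g, ∃ n : ℕ, g + n • unit ∈ pos ∧ n • unit - g ∈ pos

namespace UnitalOrderedGroup

attribute [instance] UnitalOrderedGroup.group

/-- The order `g ≤ h` given by the positive cone. -/
def LE (G : UnitalOrderedGroup) (g h : G.carrier) : Prop := h - g ∈ G.pos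

/-- `w` is an order unit: `w ∈ G₊` and each `g` satisfies `-n w ≤ g ≤ n w` for some `n`. -/
def IsOrderUnit (G : UnitalOrderedGroup) (w : G.carrier) : Prop :=
  w ∈ G.pos ∧ ∀ g, ∃ n : ℕ, G.LE (-(n • w)) g ∧ G.LE g (n • w)

/-- The distinguished element is an order unit, by the structure axioms. -/
theorem isOrderUnit_unit (G : UnitalOrderedGroup) : G.IsOrderUnit G.unit :=
  ⟨G.unit_mem, fun g => by
    obtain ⟨n, h1, h2⟩ := G.unit_spec g
    exact ⟨n, by simpa [LE] using h1, h2⟩⟩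

/-- `nx ≥ 0` for some `n > 0` implies `x ≥ 0`. -/
def Unperforated (G : UnitalOrderedGroup) : Prop :=
  ∀ (x : G.carrier) (n : ℕ), 0 < n → G.LE 0 (n • x) → G.LE 0 x

/-- The Riesz interpolation property. -/
def RieszInterpolation (G : UnitalOrderedGroup) : Prop :=
  ∀ x₀ x₁ y₀ y₁ : G.carrier, G.LE x₀ y₀ → G.LE x₀ y₁ → G.LE x₁ y₀ → G.LE x₁ y₁ →
    ∃ z, G.LE x₀ z ∧ G.LE x₁ z ∧ G.LE z y₀ ∧ G.LE z y₁

/-- Dimension groups: countable, unperforated, with Riesz interpolation. -/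
def IsDimensionGroup (G : UnitalOrderedGroup) : Prop :=
  Countable G.carrier ∧ G.Unperforated ∧ G.RieszInterpolation

/-- Simplicity: every nonzero positive element is an order unit. -/
def IsSimple (G : UnitalOrderedGroup) : Prop :=
  ∀ g ∈ G.pos, g ≠ 0 → G.IsOrderUnit g

/-- `G` and `H` are isomorphic as ordered abelian groups: some group isomorphism matches the
positive cones (it is not required to match the units). -/
def OrderIsomorphic (G H : UnitalOrderedGroup) : Prop :=
  ∃ e : G.carrier ≃+ H.carrier, ∀ g, e g ∈ H.pos ↔ g ∈ G.pos

end UnitalOrderedGroup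

/-! ### The language `{+, ≤, u}` of pointed ordered groups -/

/-- Function symbols: a constant `u` and a binary `+`. -/
inductive PointedFun : ℕ → Type
  | unit : PointedFun 0
  | add : PointedFun 2

/-- Relation symbols: a binary `≤`. -/
inductive PointedRel : ℕ → Type
  | le : PointedRel 2

/-- The language `{+, ≤, u}`. -/
def pointedLanguage : FirstOrder.Language.{0, 0} := ⟨PointedFun, PointedRel⟩

/-- A unital ordered abelian group as a structure in the language `{+, ≤, u}`. -/
instance (G : UnitalOrderedGroup) : pointedLanguage.Structure G.carrier where
  funMap {_} f :=
    match f with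
    | PointedFun.unit => fun _ => G.unit
    | PointedFun.add => fun v => v 0 + v 1
  RelMap {_} r :=
    match r with
    | PointedRel.le => fun v => G.LE (v 0) (v 1)

/-! ### Groups of continuous rational functions with the strict order -/

/-- `LocallyConstant X ℚ` consists of the functions `X → ℚ` that are continuous for the discrete
topology on `ℚ`. -/
theorem isLocallyConstant_iff_continuous_discrete {X : Type*} [TopologicalSpace X] (f : X → ℚ) :
    IsLocallyConstant f ↔ @Continuous X ℚ _ ⊥ f :=
  letI : TopologicalSpace ℚ := ⊥
  haveI : DiscreteTopology ℚ := ⟨rfl⟩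
  IsLocallyConstant.iff_continuous f

/-- The strict order `f ≪ g` on rational functions: `f = g` or `f x < g x` for all `x`. -/
def StrictLE {X : Type*} [TopologicalSpace X] (f g : LocallyConstant X ℚ) : Prop :=
  f = g ∨ ∀ x, f x < g x

/-- A locally constant rational function on a compact space is bounded. -/
theorem LocallyConstant.exists_nat_bound {X : Type*} [TopologicalSpace X] [CompactSpace X]
    (f : LocallyConstant X ℚ) : ∃ n : ℕ, 0 < n ∧ ∀ x, |f x| < n := by
  obtain ⟨B, hB⟩ := (f.range_finite.image abs).bddAbove
  obtain ⟨n, hn⟩ := exists_nat_gt (max B 0)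
  refine ⟨n, ?_, fun x => ?_⟩
  · have : (0 : ℚ) < n := lt_of_le_of_lt (le_max_right _ _) hn
    exact_mod_cast this
  · exact lt_of_le_of_lt ((hB ⟨f x, ⟨x, rfl⟩, rfl⟩).trans (le_max_left _ _)) hn

/-- For compact `X`, the triple `(G_X, {g | 0 ≪ g}, 1)`, where `G_X` is the group of functions
`X → ℚ` that are continuous for the discrete topology on `ℚ`. -/
def strictGroup (X : Type*) [TopologicalSpace X] [CompactSpace X] : UnitalOrderedGroup where
  carrier := LocallyConstant X ℚ
  pos := {g | StrictLE 0 g}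
  unit := 1
  zero_mem := Or.inl rfl
  add_mem := by
    rintro g (rfl | hg) h (rfl | hh)
    · left; simp
    · right; simpa using hh
    · right; simpa using hg
    · right; intro x
      have h1 : 0 < g x := hg x
      have h2 : 0 < h x := hh x
      change 0 < g x + h x
      linarith
  exists_sub := by
    intro g
    obtain ⟨n, hn, hb⟩ := g.exists_nat_bound
    have hn' : (0 : ℚ) < n := by exact_mod_cast hn
    refine ⟨g + LocallyConstant.const X (n : ℚ), Or.inr fun x => ?_,
      LocallyConstant.const X (n : ℚ), Or.inr fun x => hn', by simp⟩
    change 0 < g x + (n : ℚ)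
    have := (abs_lt.1 (hb x)).1
    linarith
  eq_zero := by
    rintro g (hg | hg) (hg' | hg')
    · exact hg.symm
    · exact hg.symm
    · exact neg_eq_zero.1 hg'.symm
    · ext x
      have h1 : 0 < g x := hg x
      have h2 : 0 < -(g x) := hg' x
      linarith
  unit_mem := Or.inr fun _ => zero_lt_one
  unit_spec := by
    intro g
    obtain ⟨n, -, hb⟩ := g.exists_nat_bound
    refine ⟨n, Or.inr fun x => ?_, Or.inr fun x => ?_⟩
    · change 0 < g x + n • (1 : ℚ)
      have := (abs_lt.1 (hb x)).1
      rw [nsmul_one]; linarith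
    · change 0 < n • (1 : ℚ) - g x
      have := (abs_lt.1 (hb x)).2
      rw [nsmul_one]; linarith

/-- The order of `strictGroup X` is the strict order `≪`. -/
theorem strictGroup_le_iff {X : Type*} [TopologicalSpace X] [CompactSpace X]
    (f g : LocallyConstant X ℚ) : (strictGroup X).LE f g ↔ StrictLE f g := by
  change ((0 : LocallyConstant X ℚ) = g - f ∨ ∀ x, 0 < g x - f x) ↔ _
  simp only [StrictLE, sub_pos]
  rw [eq_comm, sub_eq_zero, eq_comm]

/-- The ordinal `β + 1 = {γ | γ ≤ β}`, with the order topology, is compact. -/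
instance ordinalIicCompactSpace (β : Ordinal.{0}) : CompactSpace (Set.Iic β) := by
  rw [← isCompact_iff_compactSpace, ← Set.Icc_bot]
  exact isCompact_Icc

/-- The unital ordered group `𝒢_{β+1}` of functions on the ordinal `β + 1 = {γ | γ ≤ β}`. -/
def ordinalGroup (β : Ordinal.{0}) : UnitalOrderedGroup := strictGroup (Set.Iic β)

/-! Both halves rest on Cantor–Bendixson rank: among positive ordinals, the points of rank at least
`γ` are the multiples of `ω ^ γ`. Since `0` is divisible by every power, spaces are compared with
intervals `(0, c]`.

Equivalence is a back-and-forth argument. An atomic formula depends only on which joint values a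
tuple of functions attains. The invariant `FiberRel γ` says that corresponding joint fibers are
copies of intervals of equal length, or both of length at least `ω ^ γ`. A new function cuts each
fiber into finitely many clopen pieces, and `OrdinalRel.exists_split` imitates the cut at the cost
of one rank, which pays for one quantifier. At the start both lengths are at least `ε_α = ω ^ ε_α`,
so quantifier rank `ε_α` is reached.

For non-isomorphism, an isomorphism for the strict order is one for the pointwise order, hence a
weighted composition `f ↦ (f ∘ σ) * e 1` with `σ` a continuous injection of the underlying ordinals.
Such maps preserve divisibility by `ω ^ γ`, so `ε_β = ω ^ ε_β` would give `ε_β ≤ 1 + ε_α = ε_α`. -/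

open Set Filter Topology Ordinal in
/-- Continuous injective maps between ordinals do not decrease the Cantor–Bendixson rank. -/
theorem Ordinal.opow_dvd_of_continuousOn_injOn {A : Set Ordinal.{0}} (hA : IsOpen A)
    {f : Ordinal.{0} → Ordinal.{0}} (hf : ContinuousOn f A) (hi : InjOn f A) (γ : Ordinal.{0}) :
    ∀ x ∈ A, x ≠ 0 → ω ^ γ ∣ x → ω ^ γ ∣ f x := by
  induction γ using WellFoundedLT.induction with
  | ind γ ih =>
  intro x hx hx0 hdvd
  by_contra hnd
  set r := f x % ω ^ γ with hr
  set q := f x / ω ^ γ with hq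
  have hpos : ω ^ γ ≠ 0 := (opow_pos γ omega0_pos).ne'
  have hyq : ω ^ γ * q + r = f x := div_add_mod _ _
  have hr0 : r ≠ 0 := fun h => hnd (dvd_of_mod_eq_zero h)
  have hrlt : r < ω ^ γ := mod_lt _ hpos
  set δ := log ω r with hδ
  have hδγ : δ < γ := (lt_opow_iff_log_lt one_lt_omega0 hr0).1 hrlt
  -- Only finitely many multiples of `ω ^ δ` lie in `[ω ^ γ * q, f x]`, but injectivity and
  -- induction at `δ` will send infinitely many multiples near `x` there.
  obtain ⟨n, hn⟩ : ∃ n : ℕ, r < ω ^ δ * n := by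
    have h1 := lt_opow_succ_log_self one_lt_omega0 r
    rw [opow_succ] at h1
    obtain ⟨m, hm, h2⟩ :=
      ((isNormal_mul_right (opow_pos _ omega0_pos)).lt_iff_exists_lt isSuccLimit_omega0).1 h1
    obtain ⟨n, rfl⟩ := lt_omega0.1 hm
    exact ⟨n, h2⟩
  have hδpos : 0 < ω ^ δ := opow_pos δ omega0_pos
  obtain ⟨w, hw⟩ : ω ^ (δ + 1) ∣ x :=
    (opow_dvd_opow ω (Order.add_one_le_of_lt hδγ)).trans hdvd
  obtain ⟨Q, hQ⟩ : ω ^ δ ∣ ω ^ γ * q := (opow_dvd_opow ω hδγ.le).trans (dvd_mul_right _ _)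
  have hw0 : w ≠ 0 := by rintro rfl; simp [hx0] at hw
  have hxw : x = ω ^ δ * (ω * w) := by rw [hw, opow_add, opow_one, mul_assoc]
  have hlim : Order.IsSuccLimit (ω * w) :=
    isSuccLimit_mul_left isSuccLimit_omega0 (pos_iff_ne_zero.2 hw0)
  have hnhds : {z | z ∈ A ∧ ω ^ γ * q < f z ∧ f z < Order.succ (f x)} ∈ 𝓝 x := by
    have h1 : Ioo (ω ^ γ * q) (Order.succ (f x)) ∈ 𝓝 (f x) :=
      Ioo_mem_nhds (by
        conv_rhs => rw [← hyq]
        exact lt_add_of_pos_right _ (pos_iff_ne_zero.2 hr0)) (Order.lt_succ _)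
    filter_upwards [hA.mem_nhds hx, (hf.continuousAt (hA.mem_nhds hx)) h1] with z h2 h3
    exact ⟨h2, h3⟩
  obtain ⟨t, ht, hts⟩ := exists_Ioc_subset_of_mem_nhds hnhds ⟨0, pos_iff_ne_zero.2 hx0⟩
  set u := t / ω ^ δ with hu
  have hulim : u < ω * w := by
    rw [hu, ← lt_mul_iff_div_lt hδpos.ne', ← hxw]; exact ht
  have hadd : ∀ k : ℕ, u + 1 + k < ω * w := by
    intro k
    induction k with
    | zero => simpa using hlim.succ_lt hulim
    | succ k ihk =>
      rw [Nat.cast_succ, ← add_assoc]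
      exact hlim.succ_lt ihk
  have hmem : ∀ k : ℕ, ω ^ δ * (u + 1 + k) ∈ Ioc t x := by
    intro k
    refine ⟨(lt_mul_succ_div t hδpos.ne').trans_le ?_, ?_⟩
    · exact mul_le_mul_right (show Order.succ u ≤ u + 1 + k from le_add_right le_rfl) _
    · rw [hxw]
      exact mul_le_mul_right (hadd k).le _
  have hs : ∀ k : ℕ, ∃ s, f (ω ^ δ * (u + 1 + k)) = ω ^ δ * s ∧ s ∈ Ico Q (Q + n) := by
    intro k
    obtain ⟨h1, h2, h3⟩ := hts (hmem k)
    obtain ⟨s, hs⟩ := ih δ hδγ _ h1 (mul_ne_zero hδpos.ne' (by simp)) (dvd_mul_right _ _)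
    refine ⟨s, hs, ?_, ?_⟩
    · rw [hs, hQ] at h2
      exact (lt_of_mul_lt_mul_left' h2).le
    · have h4 : ω ^ δ * s < ω ^ δ * (Q + n) := by
        rw [← hs, mul_add (ω ^ δ) Q, ← hQ]
        refine (Order.lt_succ_iff.1 h3).trans_lt ?_
        conv_lhs => rw [← hyq]
        exact (add_lt_add_iff_left _).2 hn
      exact lt_of_mul_lt_mul_left' h4
  choose s hs1 hs2 using hs
  have hsinj : Function.Injective s := by
    intro k l hkl
    have h1 : f (ω ^ δ * (u + 1 + k)) = f (ω ^ δ * (u + 1 + l)) := by rw [hs1, hs1, hkl]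
    have h2 := hi (hts (hmem k)).1 (hts (hmem l)).1 h1
    have h3 := mul_left_cancel₀ hδpos.ne' h2
    exact_mod_cast add_left_cancel h3
  have hfin : (Ico Q (Q + n)).Finite := by
    refine ((finite_Iio n).image fun m : ℕ => Q + m).subset ?_
    rintro z ⟨h1, h2⟩
    obtain ⟨e, rfl⟩ := exists_add_of_le h1
    have h3 := (add_lt_add_iff_left _).1 h2
    obtain ⟨m, rfl⟩ := lt_omega0.1 (h3.trans (natCast_lt_omega0 n))
    exact ⟨m, by exact_mod_cast h3, rfl⟩
  exact infinite_range_of_injective hsinj (hfin.subset (range_subset_iff.2 hs2))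

/-! ### Compact intervals of ordinals and their copies -/

open Set in
/-- The inverse of a continuous bijection from a compact set to a Hausdorff one is continuous. -/
theorem IsCompact.continuousOn_of_leftInvOn {X Y : Type*} [TopologicalSpace X] [TopologicalSpace Y]
    [T2Space Y] {s : Set X} {t : Set Y} {f : X → Y} {g : Y → X} (hs : IsCompact s)
    (hf : ContinuousOn f s) (hb : BijOn f s t) (hg : LeftInvOn g f s) : ContinuousOn g t := by
  rw [continuousOn_iff_isClosed]
  intro K hK
  refine ⟨f '' (s ∩ K), ((hs.inter_right hK).image_of_continuousOn
    (hf.mono inter_subset_left)).isClosed, ?_⟩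
  ext y
  constructor
  · rintro ⟨hy, hyt⟩
    obtain ⟨x, hx, rfl⟩ := hb.surjOn hyt
    exact ⟨⟨x, ⟨hx, by simpa [hg hx] using hy⟩, rfl⟩, hyt⟩
  · rintro ⟨⟨x, ⟨hx, hxK⟩, rfl⟩, hyt⟩
    exact ⟨by simpa [hg hx] using hxK, hyt⟩

open Set in
/-- `A` is the image of the compact interval `(0, c]` of ordinals under a continuous bijection. -/
def IsOrdinalCopy {X : Type*} [TopologicalSpace X] (c : Ordinal.{0}) (A : Set X) : Prop :=
  ∃ φ : Ordinal.{0} → X, ContinuousOn φ (Ioc 0 c) ∧ BijOn φ (Ioc 0 c) A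

namespace IsOrdinalCopy

open Set Ordinal

theorem isCompact_Ioc (c : Ordinal.{0}) : IsCompact (Ioc 0 c) := by
  rw [← Order.Icc_succ_left]; exact isCompact_Icc

theorem isOpen_Ioc (s c : Ordinal.{0}) : IsOpen (Ioc s c) := by
  rw [← Order.Ioo_succ_right]; exact isOpen_Ioo

theorem nonempty_iff {X : Type*} [TopologicalSpace X] {c : Ordinal.{0}} {A : Set X}
    (h : IsOrdinalCopy c A) : A.Nonempty ↔ 0 < c := by
  obtain ⟨φ, -, hb⟩ := h
  rw [← hb.image_eq, image_nonempty, nonempty_Ioc]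

theorem image {X Y : Type*} [TopologicalSpace X] [TopologicalSpace Y] {c : Ordinal.{0}} {A : Set X}
    (h : IsOrdinalCopy c A) {f : X → Y} (hf : ContinuousOn f A) (hi : InjOn f A) :
    IsOrdinalCopy c (f '' A) := by
  obtain ⟨φ, hc, hb⟩ := h
  exact ⟨f ∘ φ, hf.comp hc hb.mapsTo, hi.bijOn_image.comp hb⟩

/-- Closed bounded sets of positive ordinals are copies of ordinals. -/
theorem exists_of_isClosed {A : Set Ordinal.{0}} (hA : IsClosed A) {c : Ordinal.{0}}
    (hc : A ⊆ Ioc 0 c) : ∃ a, IsOrdinalCopy a A := by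
  -- The tail makes the set unbounded, so that it has an enumeration, normal because the set is
  -- closed; the added `0` makes the enumeration fix `0`, so `A` is indexed by positive ordinals.
  set s : Set Ordinal.{0} := insert 0 A ∪ Ici (Order.succ c) with hs
  have hAc : IsClosed (insert 0 A) := isClosed_singleton.union hA
  have hsc : IsClosed s := hAc.union isClosed_Ici
  have hunb : ¬ BddAbove s := fun h =>
    not_bddAbove_Ici (Order.succ c) (h.mono subset_union_right)
  have hnorm : Order.IsNormal (enumOrd s) := isNormal_enumOrd
    (fun t ht hne hb => hsc.closure_subset_iff.2 ht (csSup_mem_closure hne hb)) hunb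
  have h0 : enumOrd s 0 = 0 := by
    rw [enumOrd_zero]
    exact le_antisymm (csInf_le' (Or.inl (mem_insert _ _))) (zero_le)
  have hK : IsCompact (insert 0 A) := by
    refine (isCompact_Icc (a := 0) (b := c)).of_isClosed_subset hAc ?_
    rintro x (rfl | hx)
    · exact ⟨le_rfl, zero_le⟩
    · exact Ioc_subset_Icc_self (hc hx)
  obtain ⟨m, hm, hmax⟩ := hK.exists_isGreatest ⟨0, mem_insert _ _⟩
  obtain ⟨a, rfl⟩ := enumOrd_surjective hunb (Or.inl hm : m ∈ s)
  have hmono := enumOrd_strictMono hunb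
  have hac : enumOrd s a ≤ c := by
    rcases hm with h | h
    · rw [h]; exact zero_le
    · exact (hc h).2
  refine ⟨a, enumOrd s, hnorm.continuous.continuousOn, ?_, hmono.injective.injOn, ?_⟩
  · rintro x ⟨hx0, hxa⟩
    have h1 : 0 < enumOrd s x := h0 ▸ hmono hx0
    have h2 : enumOrd s x ≤ c := (hmono.monotone hxa).trans hac
    rcases enumOrd_mem hunb x with (h | h) | h
    · exact absurd h h1.ne'
    · exact h
    · exact absurd (Order.succ_le_iff.1 h) h2.not_gt
  · intro y hy
    obtain ⟨x, rfl⟩ := enumOrd_surjective hunb (Or.inl (Or.inr hy) : y ∈ s)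
    refine ⟨x, ⟨?_, hmono.le_iff_le.1 (hmax (Or.inr hy))⟩, rfl⟩
    exact hmono.lt_iff_lt.1 (h0.trans_lt (hc hy).1)

/-- The inverse of the parametrization is a continuous injection of `A` into `(0, c]`, so it sends
`x` to a positive multiple of `ω ^ γ`. -/
theorem opow_le {A : Set Ordinal.{0}} (hA : IsOpen A) {c γ x : Ordinal.{0}}
    (h : IsOrdinalCopy c A) (hx : x ∈ A) (hx0 : x ≠ 0) (hd : ω ^ γ ∣ x) : ω ^ γ ≤ c := by
  obtain ⟨φ, hφ, hb⟩ := h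
  have hg := hb.injOn.leftInvOn_invFunOn
  have hgc := (isCompact_Ioc c).continuousOn_of_leftInvOn hφ hb hg
  have hinv := hb.invOn_invFunOn
  have hgi : InjOn (Function.invFunOn φ (Ioc 0 c)) A := hinv.2.injOn
  have h1 := opow_dvd_of_continuousOn_injOn hA hgc hgi γ x hx hx0 hd
  have h2 := (hb.symm hinv.symm).mapsTo hx
  exact (le_of_dvd h2.1.ne' h1).trans h2.2

theorem Ioc_add (s d : Ordinal.{0}) : IsOrdinalCopy d (Ioc s (s + d)) := by
  refine ⟨fun x => s + x, (isNormal_add_right s).continuous.continuousOn, ?_, ?_, ?_⟩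
  · rintro x ⟨h1, h2⟩
    exact ⟨lt_add_of_pos_right _ h1, by simpa using h2⟩
  · intro x _ y _ h
    exact add_left_cancel h
  · rintro y ⟨h1, h2⟩
    obtain ⟨e, rfl⟩ := exists_add_of_le h1.le
    exact ⟨e, ⟨by simpa using h1, by simpa using h2⟩, rfl⟩

end IsOrdinalCopy

/-! ### Splitting intervals into clopen pieces -/

open Set in
/-- `p` is locally constant on the interval `(0, c]` of ordinals. -/
def LocConstOn {Q : Type*} (p : Ordinal.{0} → Q) (c : Ordinal.{0}) : Prop :=
  ∀ T : Set Q, IsClosed (Ioc 0 c ∩ p ⁻¹' T)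

/-- `c` and `d` are equal, or both are at least `ω ^ γ`. -/
def OrdinalRel (γ c d : Ordinal.{0}) : Prop := c = d ∨ (ω ^ γ ≤ c ∧ ω ^ γ ≤ d)

section Partition

open Set Ordinal

variable {Q : Type*}

theorem LocConstOn.isOpen_fiber {p : Ordinal.{0} → Q} {c : Ordinal.{0}} (h : LocConstOn p c)
    (T : Set Q) : IsOpen (Ioc 0 c ∩ p ⁻¹' T) := by
  have h1 : Ioc 0 c ∩ p ⁻¹' T = Ioc 0 c \ (Ioc 0 c ∩ p ⁻¹' Tᶜ) := by
    ext x; simp only [mem_inter_iff, mem_sdiff, mem_preimage, mem_compl_iff]; tauto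
  rw [h1]
  exact (IsOrdinalCopy.isOpen_Ioc 0 c).sdiff (h _)

theorem LocConstOn.exists_append {r : Ordinal.{0} → Q} {s : Ordinal.{0}} (hr : LocConstOn r s)
    {q : Q} (hq : Ioc 0 s ∩ r ⁻¹' {q} = ∅) (d : Ordinal.{0}) :
    ∃ r' : Ordinal.{0} → Q, LocConstOn r' (s + d) ∧
      IsOrdinalCopy d (Ioc 0 (s + d) ∩ r' ⁻¹' {q}) ∧
      ∀ q' ≠ q, Ioc 0 (s + d) ∩ r' ⁻¹' {q'} = Ioc 0 s ∩ r ⁻¹' {q'} := by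
  classical
  have hsd : s ≤ s + d := le_add_right le_rfl
  have hq' : ∀ x, 0 < x → x ≤ s → r x ≠ q := fun x h1 h2 h3 =>
    (hq ▸ (⟨⟨h1, h2⟩, h3⟩ : x ∈ Ioc 0 s ∩ r ⁻¹' {q}) : x ∈ (∅ : Set Ordinal))
  refine ⟨fun x => if x ≤ s then r x else q, fun T => ?_, ?_, fun q' hne => ?_⟩
  · have h1 : Ioc 0 (s + d) ∩ (fun x => if x ≤ s then r x else q) ⁻¹' T =
        (Ioc 0 s ∩ r ⁻¹' T) ∪ (Icc (Order.succ s) (s + d) ∩ {_x | q ∈ T}) := by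
      ext x
      by_cases hx : x ≤ s
      · simp [hx, hx.trans hsd]
      · simp [hx, not_le.1 hx, (zero_le).trans_lt (not_le.1 hx)]
    rw [h1]
    exact (hr T).union (isClosed_Icc.inter isClosed_const)
  · convert IsOrdinalCopy.Ioc_add s d using 1
    ext x
    by_cases hx : x ≤ s
    · have := hq' x
      simp only [mem_inter_iff, mem_Ioc, mem_preimage, hx, if_true, mem_singleton_iff,
        hx.not_gt, false_and, iff_false, not_and]
      exact fun h => this h.1 hx
    · simp [hx, not_le.1 hx, (zero_le).trans_lt (not_le.1 hx)]
  · ext x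
    by_cases hx : x ≤ s
    · simp [hx, hx.trans hsd]
    · simp [hx, hne.symm]

/-- Blocks of the prescribed lengths are laid end to end. Powers of `ω` are additively principal,
which gives the bound on the total length. -/
theorem exists_partition [Nonempty Q] (F : Finset Q) (d : Q → Ordinal.{0}) :
    ∃ (s : Ordinal.{0}) (r : Ordinal.{0} → Q), LocConstOn r s ∧
      (∀ q ∈ F, IsOrdinalCopy (d q) (Ioc 0 s ∩ r ⁻¹' {q})) ∧
      (∀ q ∉ F, Ioc 0 s ∩ r ⁻¹' {q} = ∅) ∧
      ∀ γ : Ordinal.{0}, (∀ q ∈ F, d q < ω ^ γ) → s < ω ^ γ := by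
  classical
  induction F using Finset.induction_on with
  | empty =>
    exact ⟨0, fun _ => Classical.arbitrary Q, fun T => by simp, by simp, by simp,
      fun γ _ => opow_pos γ omega0_pos⟩
  | insert q F hqF ih =>
    obtain ⟨s, r, hr, hin, hout, hlt⟩ := ih
    obtain ⟨r', h1, h2, h3⟩ := hr.exists_append (hout q hqF) (d q)
    refine ⟨s + d q, r', h1, fun q' hq' => ?_, fun q' hq' => ?_, fun γ hγ => ?_⟩
    · rcases Finset.mem_insert.1 hq' with rfl | hq'
      · exact h2
      · rw [h3 q' (by rintro rfl; exact hqF ‹_›)]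
        exact hin q' hq'
    · rw [Finset.mem_insert, not_or] at hq'
      rw [h3 q' hq'.1, hout q' hq'.2]
    · exact isPrincipal_add_omega0_opow γ
        (hlt γ fun q' hq' => hγ q' (Finset.mem_insert_of_mem hq'))
        (hγ q (Finset.mem_insert_self _ _))

/-- Splitting related intervals into related pieces, at the cost of one rank. -/
theorem OrdinalRel.exists_split {γ c d : Ordinal.{0}} (h : OrdinalRel (γ + 1) c d)
    {p : Ordinal.{0} → Q} (hp : LocConstOn p c) (hfin : (p '' Ioc 0 c).Finite) :
    ∃ r : Ordinal.{0} → Q, LocConstOn r d ∧ ∀ q, ∃ c' d',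
      IsOrdinalCopy c' (Ioc 0 c ∩ p ⁻¹' {q}) ∧ IsOrdinalCopy d' (Ioc 0 d ∩ r ⁻¹' {q}) ∧
        OrdinalRel γ c' d' := by
  classical
  have hex : ∀ q, ∃ c', IsOrdinalCopy c' (Ioc 0 c ∩ p ⁻¹' {q}) := fun q =>
    IsOrdinalCopy.exists_of_isClosed (hp {q}) inter_subset_left
  rcases h with rfl | ⟨hc, hd⟩
  · refine ⟨p, hp, fun q => ?_⟩
    obtain ⟨c', hc'⟩ := hex q
    exact ⟨c', c', hc', hc', Or.inl rfl⟩
  choose a ha using hex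
  have hlt : ω ^ γ < ω ^ (γ + 1) := (opow_lt_opow_iff_right one_lt_omega0).2 (lt_add_one γ)
  set x := ω ^ γ with hx
  have hx0 : 0 < x := opow_pos γ omega0_pos
  have hxc : x ∈ Ioc 0 c := ⟨hx0, hlt.le.trans hc⟩
  -- The piece containing the point `ω ^ γ` is long; on the other side it will absorb whatever
  -- length is left over.
  set q₀ := p x with hq₀
  have hbig : ω ^ γ ≤ a q₀ :=
    (ha q₀).opow_le (hp.isOpen_fiber _) ⟨hxc, rfl⟩ hx0.ne' dvd_rfl
  have : Nonempty Q := ⟨q₀⟩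
  -- Truncating the other pieces at `ω ^ γ` keeps them related and their total below `ω ^ (γ + 1) ≤
  -- d`, so the remainder `e` is still at least `ω ^ γ`.
  obtain ⟨s, r, hr, hin, hout, hs⟩ := exists_partition (hfin.toFinset.erase q₀)
    fun q => min (a q) (ω ^ γ)
  have hslt : s < ω ^ (γ + 1) := hs (γ + 1) fun q _ => (min_le_right _ _).trans_lt hlt
  obtain ⟨e, he⟩ := exists_add_of_le (hslt.le.trans hd)
  have hle : ω ^ γ ≤ e := by
    by_contra hcon
    exact (isPrincipal_add_omega0_opow (γ + 1) hslt ((not_le.1 hcon).trans hlt)).not_ge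
      (hd.trans_eq he)
  obtain ⟨r', h1, h2, h3⟩ := hr.exists_append (hout q₀ (by simp)) e
  rw [← he] at h1 h2 h3
  refine ⟨r', h1, fun q => ?_⟩
  by_cases hq : q = q₀
  · subst hq
    exact ⟨a q₀, e, ha _, h2, Or.inr ⟨hbig, hle⟩⟩
  rw [h3 q hq]
  by_cases hqF : q ∈ p '' Ioc 0 c
  · refine ⟨a q, min (a q) (ω ^ γ), ha q, hin q (by simp [hq, hfin.mem_toFinset.2 hqF]), ?_⟩
    rcases le_total (a q) (ω ^ γ) with h | h
    · exact Or.inl (min_eq_left h).symm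
    · exact Or.inr ⟨h, (min_eq_right h).ge⟩
  · refine ⟨a q, 0, ha q, ?_, Or.inl ?_⟩
    · rw [hout q fun h => hqF (hfin.mem_toFinset.1 (Finset.mem_of_mem_erase h))]
      exact ⟨fun x => x, continuousOn_id, by simp⟩
    · by_contra h0
      obtain ⟨y, hy, hyq⟩ := (ha q).nonempty_iff.2 (pos_iff_ne_zero.2 h0)
      exact hqF ⟨y, hy, hyq⟩

end Partition

/-! ### Back-and-forth on tuples of functions -/

section BackAndForth

open Set

variable {X Y : Type*} [TopologicalSpace X] [TopologicalSpace Y]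

/-- The joint fibers of two tuples of functions are copies of ordinals related at rank `γ`. -/
def FiberRel (γ : Ordinal.{0}) {n : ℕ} (f : Fin n → LocallyConstant X ℚ)
    (g : Fin n → LocallyConstant Y ℚ) : Prop :=
  ∀ v : Fin n → ℚ, ∃ c d, IsOrdinalCopy c {x | ∀ i, f i x = v i} ∧
    IsOrdinalCopy d {y | ∀ i, g i y = v i} ∧ OrdinalRel γ c d

theorem OrdinalRel.symm {γ c d : Ordinal.{0}} (h : OrdinalRel γ c d) : OrdinalRel γ d c :=
  h.imp Eq.symm And.symm

theorem OrdinalRel.mono {γ δ c d : Ordinal.{0}} (h : OrdinalRel γ c d) (hd : δ ≤ γ) :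
    OrdinalRel δ c d :=
  have hle := Ordinal.opow_le_opow_right Ordinal.omega0_pos hd
  h.imp_right fun h => ⟨hle.trans h.1, hle.trans h.2⟩

namespace FiberRel

variable {γ : Ordinal.{0}} {n : ℕ} {f : Fin n → LocallyConstant X ℚ}
  {g : Fin n → LocallyConstant Y ℚ}

theorem symm (h : FiberRel γ f g) : FiberRel γ g f := fun v =>
  let ⟨c, d, hc, hd, hr⟩ := h v
  ⟨d, c, hd, hc, hr.symm⟩

theorem mono (h : FiberRel γ f g) {δ : Ordinal.{0}} (hd : δ ≤ γ) : FiberRel δ f g := fun v =>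
  let ⟨c, d, hc, hd', hr⟩ := h v
  ⟨c, d, hc, hd', hr.mono hd⟩

theorem exists_eq (h : FiberRel γ f g) (x : X) : ∃ y, ∀ i, f i x = g i y := by
  obtain ⟨c, d, hc, hd, hr⟩ := h fun i => f i x
  have hcpos : 0 < c := hc.nonempty_iff.1 ⟨x, fun _ => rfl⟩
  have hdpos : 0 < d := by
    rcases hr with rfl | hr
    · exact hcpos
    · exact (Ordinal.opow_pos γ Ordinal.omega0_pos).trans_le hr.2
  obtain ⟨y, hy⟩ := hd.nonempty_iff.2 hdpos
  exact ⟨y, fun i => (hy i).symm⟩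

/-- Each joint fiber is split separately, and the answers are transported to `Y` and glued. The
glued function is locally constant because the joint fibers of `g` are open and the pieces inside
them are compact, hence closed. -/
theorem forth [CompactSpace X] [T2Space Y] (h : FiberRel (γ + 1) f g) (a : LocallyConstant X ℚ) :
    ∃ b : LocallyConstant Y ℚ,
      FiberRel γ (Fin.snoc f a : Fin (n + 1) → LocallyConstant X ℚ)
        (Fin.snoc g b : Fin (n + 1) → LocallyConstant Y ℚ) := by
  choose c d hc hd hr using h
  choose φ hφ hφb using hc
  choose ψ hψ hψb using hd
  have hp : ∀ v, LocConstOn (a ∘ φ v) (c v) := fun v T =>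
    (hφ v).preimage_isClosed_of_isClosed (t := a ⁻¹' T) (IsOrdinalCopy.isCompact_Ioc _).isClosed
      (by rw [← isOpen_compl_iff]; exact a.isLocallyConstant Tᶜ)
  have hfin : ∀ v, ((a ∘ φ v) '' Ioc 0 (c v)).Finite := fun v =>
    a.range_finite.subset (by rintro _ ⟨x, -, rfl⟩; exact ⟨_, rfl⟩)
  choose r hrc hrs using fun v => (hr v).exists_split (hp v) (hfin v)
  set k : Y → ℚ := fun y =>
    r (fun i => g i y) (Function.invFunOn (ψ fun i => g i y) (Ioc 0 (d fun i => g i y)) y) with hk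
  have hkv : ∀ (v : Fin n → ℚ) (T : Set ℚ), {y | ∀ i, g i y = v i} ∩ k ⁻¹' T =
      ψ v '' (Ioc 0 (d v) ∩ r v ⁻¹' T) := by
    intro v T
    ext y
    constructor
    · rintro ⟨hy, hyT⟩
      obtain rfl : (fun i => g i y) = v := funext hy
      obtain ⟨x, hx, hxy⟩ := (hψb _).surjOn hy
      refine ⟨x, ⟨hx, ?_⟩, hxy⟩
      have h1 : Function.invFunOn (ψ fun i => g i y) (Ioc 0 (d fun i => g i y)) y = x := by
        conv_lhs => enter [3]; rw [← hxy]
        exact (hψb _).injOn.leftInvOn_invFunOn hx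
      rw [mem_preimage, ← h1]
      exact hyT
    · rintro ⟨x, ⟨hx, hxT⟩, rfl⟩
      have hy := (hψb v).mapsTo hx
      refine ⟨hy, ?_⟩
      have hv : (fun i => g i (ψ v x)) = v := funext hy
      have h1 : Function.invFunOn (ψ v) (Ioc 0 (d v)) (ψ v x) = x :=
        (hψb _).injOn.leftInvOn_invFunOn hx
      simp only [mem_preimage, hk, hv, h1]
      exact hxT
  have hkc : IsLocallyConstant k := by
    intro T
    have h1 : k ⁻¹' T = ⋃ v : Fin n → ℚ,
        {y | ∀ i, g i y = v i} \ ({y | ∀ i, g i y = v i} ∩ k ⁻¹' Tᶜ) := by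
      ext y
      simp only [mem_preimage, mem_iUnion, mem_sdiff, mem_ofPred_eq, mem_inter_iff, mem_compl_iff]
      exact ⟨fun h => ⟨fun i => g i y, fun _ => rfl, fun h' => h'.2 h⟩,
        fun ⟨v, h1, h2⟩ => by_contra fun h => h2 ⟨h1, h⟩⟩
    rw [h1]
    refine isOpen_iUnion fun v => IsOpen.sdiff ?_ ?_
    · rw [ofPred_forall]
      exact isOpen_iInter_of_finite fun i => (g i).isLocallyConstant.isOpen_fiber _
    · rw [hkv]
      exact (((IsOrdinalCopy.isCompact_Ioc _).of_isClosed_subset (hrc v _)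
        inter_subset_left).image_of_continuousOn ((hψ v).mono inter_subset_left)).isClosed
  refine ⟨⟨k, hkc⟩, fun v => ?_⟩
  obtain ⟨c', d', h1, h2, h3⟩ := hrs (Fin.init v) (v (Fin.last n))
  refine ⟨c', d', ?_, ?_, h3⟩
  · have h4 := h1.image ((hφ _).mono inter_subset_left) ((hφb _).injOn.mono inter_subset_left)
    rw [preimage_comp, image_inter_preimage, (hφb _).image_eq] at h4
    convert h4 using 1
    ext z
    simp [Fin.forall_fin_succ', Fin.init]
  · have h4 := h2.image ((hψ _).mono inter_subset_left) ((hψb _).injOn.mono inter_subset_left)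
    rw [← hkv] at h4
    convert h4 using 1
    ext z
    simp [Fin.forall_fin_succ', Fin.init]

variable [CompactSpace X] [CompactSpace Y]

theorem _root_.strictGroup_realize_term_apply (f : Fin n → LocallyConstant X ℚ)
    (g : Fin n → LocallyConstant Y ℚ) {x : X} {y : Y} (h : ∀ i, f i x = g i y)
    (t : pointedLanguage.Term (Fin n)) :
    (show LocallyConstant X ℚ from t.realize (M := (strictGroup X).carrier) f) x =
      (show LocallyConstant Y ℚ from t.realize (M := (strictGroup Y).carrier) g) y := by
  induction t with
  | var i => exact h i
  | func F ts ih =>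
    cases F with
    | unit => rfl
    | add => exact congrArg₂ (· + ·) (ih 0) (ih 1)

theorem realize_equal (h : FiberRel γ f g) (t s : pointedLanguage.Term (Fin n))
    (he : (InfFormula.equal t s).Realize (strictGroup X).carrier f) :
    (InfFormula.equal t s).Realize (strictGroup Y).carrier g := by
  refine LocallyConstant.ext fun y => ?_
  obtain ⟨x, hx⟩ := h.symm.exists_eq y
  have h1 := strictGroup_realize_term_apply g f hx
  exact (h1 t).trans ((DFunLike.congr_fun (F := LocallyConstant X ℚ) he x).trans (h1 s).symm)

theorem realize_rel (h : FiberRel γ f g) {l : ℕ} (R : pointedLanguage.Relations l)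
    (ts : Fin l → pointedLanguage.Term (Fin n))
    (he : (InfFormula.rel R ts).Realize (strictGroup X).carrier f) :
    (InfFormula.rel R ts).Realize (strictGroup Y).carrier g := by
  cases R with
  | le =>
    have he' := (strictGroup_le_iff _ _).1 he
    refine (strictGroup_le_iff _ _).2 ?_
    rcases he' with he' | he'
    · exact Or.inl (h.realize_equal (ts 0) (ts 1) he')
    · refine Or.inr fun y => ?_
      obtain ⟨x, hx⟩ := h.symm.exists_eq y
      have h1 := strictGroup_realize_term_apply g f hx
      exact (h1 (ts 0)).trans_lt ((he' x).trans_eq (h1 (ts 1)).symm)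

/-- Only quantifiers use up rank, one unit each through `forth`; connectives keep the tuples and
hence the invariant. -/
theorem realize_iff [T2Space X] [T2Space Y] (φ : InfFormula pointedLanguage n)
    (hφ : φ.qr ≤ γ) (h : FiberRel γ f g) :
    φ.Realize (strictGroup X).carrier f ↔ φ.Realize (strictGroup Y).carrier g := by
  induction φ generalizing γ with
  | equal t s => exact ⟨h.realize_equal t s, h.symm.realize_equal t s⟩
  | rel R ts => exact ⟨h.realize_rel R ts, h.symm.realize_rel R ts⟩
  | neg φ ih => exact not_congr (ih hφ h)
  | conj φ ih =>
    exact forall_congr' fun i => ih i ((Ordinal.le_iSup (fun i => (φ i).qr) i).trans hφ) h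
  | disj φ ih =>
    exact exists_congr fun i => ih i ((Ordinal.le_iSup (fun i => (φ i).qr) i).trans hφ) h
  | ex φ ih =>
    have h' : FiberRel (φ.qr + 1) f g := h.mono hφ
    constructor
    · rintro ⟨a, ha⟩
      obtain ⟨b, hb⟩ := h'.forth a
      exact ⟨b, (ih le_rfl hb).1 ha⟩
    · rintro ⟨b, hb⟩
      obtain ⟨a, ha⟩ := h'.symm.forth b
      exact ⟨a, (ih le_rfl ha.symm).2 hb⟩
  | all φ ih =>
    have h' : FiberRel (φ.qr + 1) f g := h.mono hφ
    constructor
    · intro H b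
      obtain ⟨a, ha⟩ := h'.symm.forth b
      exact (ih le_rfl ha.symm).1 (H a)
    · intro H a
      obtain ⟨b, hb⟩ := h'.forth a
      exact (ih le_rfl hb).2 (H b)

end FiberRel

theorem infEquiv_strictGroup [CompactSpace X] [CompactSpace Y] [T2Space X] [T2Space Y]
    {γ c d : Ordinal.{0}} (hX : IsOrdinalCopy c (univ : Set X)) (hY : IsOrdinalCopy d (univ : Set Y))
    (h : OrdinalRel γ c d) :
    InfEquiv pointedLanguage γ (strictGroup X).carrier (strictGroup Y).carrier := by
  intro φ hφ
  refine FiberRel.realize_iff (γ := γ) φ hφ fun v => ⟨c, d, ?_, ?_, h⟩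
  · simpa using hX
  · simpa using hY

/-- The space `c + 1` is a copy of the interval `(0, 1 + c]`. -/
theorem isOrdinalCopy_univ_Iic (c : Ordinal.{0}) :
    IsOrdinalCopy (1 + c) (univ : Set (Iic c)) := by
  have hf : Continuous fun x : Iic c => 1 + (x : Ordinal.{0}) :=
    (Ordinal.isNormal_add_right 1).continuous.comp continuous_subtype_val
  have hb : BijOn (fun x : Iic c => 1 + (x : Ordinal.{0})) univ (Ioc 0 (1 + c)) := by
    refine ⟨fun x _ => ⟨?_, add_le_add_right (mem_Iic.1 x.2) 1⟩,
      fun x _ y _ h => Subtype.ext (by simpa using h), ?_⟩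
    · exact zero_lt_one.trans_le (le_add_right le_rfl)
    · rintro y ⟨h1, h2⟩
      obtain ⟨e, rfl⟩ := exists_add_of_le (Order.one_le_iff_pos.2 h1)
      exact ⟨⟨e, by simpa using h2⟩, mem_univ _, rfl⟩
  have : Nonempty (Iic c) := ⟨⟨c, mem_Iic.2 le_rfl⟩⟩
  have hinv := hb.invOn_invFunOn
  exact ⟨_, isCompact_univ.continuousOn_of_leftInvOn hf.continuousOn hb hinv.1, hb.symm hinv.symm⟩

end BackAndForth

theorem infEquiv_ordinalGroup {γ c d : Ordinal.{0}} (hc : ω ^ γ ≤ c) (hd : ω ^ γ ≤ d) :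
    InfEquiv pointedLanguage γ (ordinalGroup c).carrier (ordinalGroup d).carrier :=
  infEquiv_strictGroup (isOrdinalCopy_univ_Iic c) (isOrdinalCopy_univ_Iic d)
    (Or.inr ⟨hc.trans (le_add_left le_rfl), hd.trans (le_add_left le_rfl)⟩)

/-! ### Order isomorphisms as weighted compositions -/

section Isomorphism

open Set

open Classical in
/-- The indicator function of `{x | x ≤ b}` on the ordinal `c + 1`. -/
noncomputable def indicatorIic {c : Ordinal.{0}} (b : Ordinal.{0}) : LocallyConstant (Iic c) ℚ where
  toFun x := if (x : Ordinal.{0}) ≤ b then 1 else 0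
  isLocallyConstant := by
    have ho : IsOpen (Iic b) := by rw [← Order.Iio_succ]; exact isOpen_Iio
    have h : IsClopen {x : Iic c | (x : Ordinal.{0}) ≤ b} :=
      ⟨isClosed_Iic.preimage continuous_subtype_val, ho.preimage continuous_subtype_val⟩
    convert (LocallyConstant.charFn ℚ h).isLocallyConstant using 1
    ext x
    change _ = (LocallyConstant.charFn ℚ h : Iic c → ℚ) x
    rw [LocallyConstant.coe_charFn, Set.indicator_apply]
    rfl

open Classical in
theorem indicatorIic_apply {c b : Ordinal.{0}} (x : Iic c) :
    indicatorIic b x = if (x : Ordinal.{0}) ≤ b then 1 else 0 := rfl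

section Lattice

variable {X Y : Type*} [TopologicalSpace X] [TopologicalSpace Y]

/-- Homomorphisms preserving the strict order also preserve the pointwise order. -/
theorem StrictLE.map_nonneg (e : LocallyConstant X ℚ →+ LocallyConstant Y ℚ)
    (he : ∀ g, StrictLE 0 g → StrictLE 0 (e g)) (f : LocallyConstant X ℚ) (hf : ∀ x, 0 ≤ f x)
    (y : Y) : 0 ≤ e f y := by
  have hnonneg : ∀ g, StrictLE 0 g → 0 ≤ e g y := by
    intro g hg
    rcases he g hg with h | h
    · rw [← h]; exact le_rfl
    · exact (h y).le
  -- `n • f + 1` is strictly positive; a negative `e f y` would contradict this for large `n`.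
  have h1 : ∀ n : ℕ, 0 ≤ n * e f y + e 1 y := by
    intro n
    have h2 := hnonneg (n • f + 1) (Or.inr fun x => by
      have := hf x
      change 0 < n • f x + 1
      positivity)
    rw [map_add, map_nsmul] at h2
    change 0 ≤ n • e f y + e 1 y at h2
    rwa [nsmul_eq_mul] at h2
  by_contra hneg
  push Not at hneg
  obtain ⟨n, hn⟩ := exists_nat_gt (e 1 y / -(e f y))
  rw [div_lt_iff₀ (by linarith)] at hn
  linarith [h1 n]

variable (e : LocallyConstant X ℚ ≃+ LocallyConstant Y ℚ)
  (hpos : ∀ f, (∀ x, 0 ≤ f x) → ∀ y, 0 ≤ e f y)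
  (hpos' : ∀ g, (∀ y, 0 ≤ g y) → ∀ x, 0 ≤ e.symm g x)

include hpos hpos'

/-- The preimage of the pointwise minimum of `e f` and `e g` lies between `0` and both `f` and `g`,
so it vanishes. -/
theorem orderIso_disjoint {f g : LocallyConstant X ℚ} (hf : ∀ x, 0 ≤ f x) (hg : ∀ x, 0 ≤ g x)
    (h : ∀ x, f x = 0 ∨ g x = 0) (y : Y) : e f y = 0 ∨ e g y = 0 := by
  set m : LocallyConstant Y ℚ :=
    ⟨fun y => min (e f y) (e g y), (e f).isLocallyConstant.comp₂ (e g).isLocallyConstant min⟩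
  have hm : ∀ y, m y = min (e f y) (e g y) := fun _ => rfl
  have hle : ∀ u : LocallyConstant X ℚ, (∀ y, m y ≤ e u y) → ∀ x, e.symm m x ≤ u x := by
    intro u hu x
    have h1 := hpos' (e u - m) (fun y => sub_nonneg.2 (hu y)) x
    rw [map_sub, e.symm_apply_apply] at h1
    exact sub_nonneg.1 h1
  have h0 := hpos' m fun y => le_min (hpos f hf y) (hpos g hg y)
  have hf' := hle f fun y => min_le_left _ _
  have hg' := hle g fun y => min_le_right _ _
  have hz : e.symm m = 0 := by
    ext x
    refine le_antisymm ?_ (h0 x)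
    rcases h x with h | h
    · exact (hf' x).trans_eq h
    · exact (hg' x).trans_eq h
  have hm0 : m = 0 := by rw [← e.apply_symm_apply m, hz, map_zero]
  have h2 : min (e f y) (e g y) = 0 := by rw [← hm, hm0]; rfl
  rcases min_choice (e f y) (e g y) with h | h
  · exact Or.inl (h ▸ h2)
  · exact Or.inr (h ▸ h2)

theorem orderIso_apply_eq_zero {f g : LocallyConstant X ℚ} (hg : ∀ x, 0 ≤ g x)
    (h : ∀ x, f x = 0 ∨ g x = 0) {y : Y} (hy : e g y ≠ 0) : e f y = 0 := by
  set a : LocallyConstant X ℚ := f.map abs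
  have ha : ∀ x, a x = |f x| := fun _ => rfl
  have h1 : e a y = 0 := (orderIso_disjoint e hpos hpos' (f := a)
    (fun x => abs_nonneg _) hg (fun x => (h x).imp_left (by rw [ha, abs_eq_zero]; exact id)) y).resolve_right
      hy
  have h2 := hpos (a - f) (fun x => sub_nonneg.2 (le_abs_self _)) y
  have h3 := hpos (a + f) (fun x => by
    have := neg_abs_le (f x)
    change 0 ≤ |f x| + f x
    linarith) y
  rw [map_sub] at h2
  rw [map_add] at h3
  change 0 ≤ e a y - e f y at h2
  change 0 ≤ e a y + e f y at h3
  linarith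

end Lattice

section Points

variable {c d : Ordinal.{0}} (e : LocallyConstant (Iic c) ℚ ≃+ LocallyConstant (Iic d) ℚ)
  (hpos : ∀ f, (∀ x, 0 ≤ f x) → ∀ y, 0 ≤ e f y)
  (hpos' : ∀ g, (∀ y, 0 ≤ g y) → ∀ x, 0 ≤ e.symm g x)
  (hone : ∀ y, 0 < e 1 y)

/-- The point of `c + 1` at which the functional `f ↦ e f y` is concentrated. -/
noncomputable def orderIsoPoint (y : Iic d) : Ordinal.{0} := sInf {b | e (indicatorIic b) y ≠ 0}

-- `e (indicatorIic b) y` is nonnegative and increasing in `b`, and positive at `b = c`, where the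
-- indicator is `1`.
include hpos hone in
theorem orderIsoPoint_le_iff (y : Iic d) (b : Ordinal.{0}) :
    orderIsoPoint e y ≤ b ↔ e (indicatorIic b) y ≠ 0 := by
  have hc : e (indicatorIic c) y ≠ 0 := by
    have : (indicatorIic c : LocallyConstant (Iic c) ℚ) = 1 := by
      ext x
      rw [indicatorIic_apply, if_pos (mem_Iic.1 x.2)]; rfl
    rw [this]
    exact (hone y).ne'
  refine ⟨fun h => ?_, fun h => csInf_le' h⟩
  have h1 : e (indicatorIic (orderIsoPoint e y)) y ≠ 0 :=
    csInf_mem (s := {b | e (indicatorIic b) y ≠ 0}) ⟨c, hc⟩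
  have h2 := hpos (indicatorIic b - indicatorIic (orderIsoPoint e y)) (fun x => by
    refine sub_nonneg.2 ?_
    rw [indicatorIic_apply, indicatorIic_apply]
    by_cases hx : (x : Ordinal.{0}) ≤ orderIsoPoint e y
    · rw [if_pos hx, if_pos (hx.trans h)]
    · rw [if_neg hx]; positivity) y
  have h3 := hpos (indicatorIic (orderIsoPoint e y)) (fun x => by
    rw [indicatorIic_apply]; positivity) y
  rw [map_sub] at h2
  have h4 : e (indicatorIic (orderIsoPoint e y)) y ≤ e (indicatorIic b) y := sub_nonneg.1 h2
  exact ((lt_of_le_of_ne h3 h1.symm).trans_le h4).ne'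

include hpos hone in
theorem orderIsoPoint_le (y : Iic d) : orderIsoPoint e y ≤ c := by
  rw [orderIsoPoint_le_iff e hpos hone]
  have : (indicatorIic c : LocallyConstant (Iic c) ℚ) = 1 := by
    ext x
    rw [indicatorIic_apply, if_pos (mem_Iic.1 x.2)]; rfl
  rw [this]
  exact (hone y).ne'

include hpos hone in
theorem continuous_orderIsoPoint : Continuous (orderIsoPoint e) := by
  have hclopen : ∀ b, IsClopen (orderIsoPoint e ⁻¹' Iic b) := by
    intro b
    have : orderIsoPoint e ⁻¹' Iic b = {y | e (indicatorIic b) y = 0}ᶜ := by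
      ext y
      exact orderIsoPoint_le_iff e hpos hone y b
    rw [this]
    exact ((e (indicatorIic b)).isLocallyConstant.isClopen_fiber 0).compl
  rw [OrderTopology.continuous_iff]
  refine fun a => ⟨?_, ?_⟩
  · rw [← compl_Iic, preimage_compl]
    exact (hclopen a).compl.isOpen
  · have : orderIsoPoint e ⁻¹' Iio a = ⋃ b : Iio a, orderIsoPoint e ⁻¹' Iic b := by
      ext y
      simp only [mem_preimage, mem_Iio, mem_iUnion, mem_Iic, Subtype.exists, exists_prop]
      exact ⟨fun h => ⟨_, h, le_rfl⟩, fun ⟨b, hb, h⟩ => h.trans_lt hb⟩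
    rw [this]
    exact isOpen_iUnion fun b => (hclopen b).isOpen

include hpos hpos' hone in
theorem orderIso_apply_eq (f : LocallyConstant (Iic c) ℚ) (y : Iic d) (x : Iic c)
    (hx : orderIsoPoint e y = x) : e f y = f x * e 1 y := by
  have hxy : e (indicatorIic x) y ≠ 0 := (orderIsoPoint_le_iff e hpos hone y x).1 hx.le
  have hnhds : {z | f z = f x} ∈ nhds x :=
    (f.isLocallyConstant.isOpen_fiber (f x)).mem_nhds rfl
  -- Take `g` to be the indicator of an interval `(a, x]` on which `f` is constant: minimality of
  -- `x` makes the part up to `a` invisible at `y`. Then `f - f x • 1` is disjoint from `g`, so its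
  -- image vanishes at `y`.
  obtain ⟨g, hg0, hgy, hgx⟩ : ∃ g : LocallyConstant (Iic c) ℚ, (∀ z, 0 ≤ g z) ∧ e g y ≠ 0 ∧
      ∀ z, f z = f x ∨ g z = 0 := by
    by_cases hmin : ∃ l, l < x
    · obtain ⟨a, hax, ha⟩ := exists_Ioc_subset_of_mem_nhds hnhds hmin
      refine ⟨indicatorIic x - indicatorIic a, fun z => ?_, ?_, fun z => ?_⟩
      · refine sub_nonneg.2 ?_
        rw [indicatorIic_apply, indicatorIic_apply]
        by_cases hz : (z : Ordinal.{0}) ≤ a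
        · rw [if_pos hz, if_pos (hz.trans (Subtype.coe_le_coe.2 hax.le))]
        · rw [if_neg hz]; positivity
      · have hay : e (indicatorIic a) y = 0 := by
          by_contra h
          have := (orderIsoPoint_le_iff e hpos hone y a).2 h
          rw [hx] at this
          exact hax.not_ge this
        rw [map_sub]
        change e (indicatorIic x) y - e (indicatorIic a) y ≠ 0
        rwa [hay, sub_zero]
      · by_cases h1 : z ≤ a
        · right
          change indicatorIic x z - indicatorIic a z = 0
          rw [indicatorIic_apply, indicatorIic_apply, if_pos (Subtype.coe_le_coe.2 h1),
            if_pos (Subtype.coe_le_coe.2 (h1.trans hax.le)), sub_self]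
        · by_cases h2 : z ≤ x
          · exact Or.inl (ha ⟨not_le.1 h1, h2⟩)
          · right
            change indicatorIic x z - indicatorIic a z = 0
            rw [indicatorIic_apply, indicatorIic_apply, if_neg (mt Subtype.coe_le_coe.1 h2),
              if_neg (mt Subtype.coe_le_coe.1 h1), sub_self]
    · refine ⟨indicatorIic x, fun z => ?_, hxy, fun z => ?_⟩
      · rw [indicatorIic_apply]; positivity
      · by_cases h : z ≤ x
        · left
          rw [le_antisymm h (not_lt.1 fun h' => hmin ⟨z, h'⟩)]
        · right
          rw [indicatorIic_apply, if_neg (mt Subtype.coe_le_coe.1 h)]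
  have h1 : e (f - f x • (1 : LocallyConstant (Iic c) ℚ)) y = 0 := by
    refine orderIso_apply_eq_zero e hpos hpos' hg0 (fun z => (hgx z).imp_left fun h => ?_) hgy
    change f z - f x * 1 = 0
    rw [h, mul_one, sub_self]
  rw [map_sub, map_rat_smul] at h1
  exact sub_eq_zero.1 h1

-- If two points had the same image, the values there of every function in the range of `e` would be
-- in a fixed nonzero ratio; since `e` is onto, an indicator separating the points refutes this.
include hpos hpos' hone in
theorem orderIsoPoint_injective : Function.Injective (orderIsoPoint e) := by
  have key : ∀ y y' : Iic d, orderIsoPoint e y = orderIsoPoint e y' → ¬ y < y' := by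
    intro y y' h hlt
    have hx := mem_Iic.2 (orderIsoPoint_le e hpos hone y)
    have h1 := orderIso_apply_eq e hpos hpos' hone (e.symm (indicatorIic y)) y ⟨_, hx⟩ rfl
    have h2 := orderIso_apply_eq e hpos hpos' hone (e.symm (indicatorIic y)) y' ⟨_, hx⟩ h.symm
    rw [e.apply_symm_apply, indicatorIic_apply, if_pos le_rfl] at h1
    rw [e.apply_symm_apply, indicatorIic_apply, if_neg (mt Subtype.coe_le_coe.1 hlt.not_ge)] at h2
    rcases mul_eq_zero.1 h2.symm with h3 | h3
    · rw [h3, zero_mul] at h1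
      exact one_ne_zero h1
    · exact (hone y').ne' h3
  intro y y' h
  exact le_antisymm (not_lt.1 (key y' y h.symm)) (not_lt.1 (key y y' h))

end Points

/-- If the groups of `c + 1` and `ω ^ γ + 1` are isomorphic, then `ω ^ γ ≤ 1 + c`. -/
theorem UnitalOrderedGroup.OrderIsomorphic.opow_le {c γ : Ordinal.{0}}
    (h : (ordinalGroup c).OrderIsomorphic (ordinalGroup (ω ^ γ))) : ω ^ γ ≤ 1 + c := by
  classical
  obtain ⟨e', he⟩ := h
  let e : LocallyConstant (Iic c) ℚ ≃+ LocallyConstant (Iic (ω ^ γ)) ℚ := e'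
  have he1 : ∀ g, StrictLE 0 g → StrictLE 0 (e g) := fun g hg => (he g).2 hg
  have he2 : ∀ g, StrictLE 0 g → StrictLE 0 (e.symm g) := fun g hg =>
    (he (e.symm g)).1 (by rw [show e' (e.symm g) = g from e.apply_symm_apply g]; exact hg)
  have hpos := StrictLE.map_nonneg e.toAddMonoidHom he1
  have hpos' := StrictLE.map_nonneg e.symm.toAddMonoidHom he2
  have hone : ∀ y, 0 < e 1 y := by
    rcases he1 1 (Or.inr fun _ => zero_lt_one) with h | h
    · have h1 : (1 : LocallyConstant (Iic c) ℚ) = 0 := by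
        rw [← e.symm_apply_apply 1, ← h, map_zero]
      exact absurd (DFunLike.congr_fun h1 ⟨c, mem_Iic.2 le_rfl⟩) one_ne_zero
    · exact h
  -- The shift by `1` makes the image of `ω ^ γ` positive, so that divisibility bounds it below; the
  -- value `0` outside the domain plays no role.
  let F : Ordinal.{0} → Ordinal.{0} := fun o =>
    if ho : o ∈ Iic (ω ^ γ) then 1 + orderIsoPoint e ⟨o, ho⟩ else 0
  have hF : ∀ y : Iic (ω ^ γ), F y = 1 + orderIsoPoint e y := fun y => dif_pos y.2
  have hcont : ContinuousOn F (Iic (ω ^ γ)) := by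
    rw [continuousOn_iff_continuous_domRestrict]
    refine ((Ordinal.isNormal_add_right 1).continuous.comp
      (continuous_orderIsoPoint e hpos hone)).congr fun y => (hF y).symm
  have hinj : InjOn F (Iic (ω ^ γ)) := by
    intro x hx y hy hxy
    rw [hF ⟨x, hx⟩, hF ⟨y, hy⟩] at hxy
    exact congrArg Subtype.val
      (orderIsoPoint_injective e hpos hpos' hone (add_left_cancel hxy))
  have hopen : IsOpen (Iic (ω ^ γ)) := by rw [← Order.Iio_succ]; exact isOpen_Iio
  have hd := Ordinal.opow_dvd_of_continuousOn_injOn hopen hcont hinj γ (ω ^ γ) (mem_Iic.2 le_rfl)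
    (Ordinal.opow_pos γ Ordinal.omega0_pos).ne' dvd_rfl
  rw [hF ⟨_, mem_Iic.2 le_rfl⟩] at hd
  refine (Ordinal.le_of_dvd ?_ hd).trans
    (add_le_add_right (orderIsoPoint_le e hpos hone _) 1)
  exact (zero_lt_one.trans_le (le_add_right le_rfl)).ne'

end Isomorphism

/-! ### Simple dimension groups and countability -/

section DimensionGroup

variable {X : Type*} [TopologicalSpace X] [CompactSpace X]

theorem strictGroup_isSimple : (strictGroup X).IsSimple := by
  intro g hg hne
  refine ⟨hg, fun f => ?_⟩
  obtain ⟨N, hN, hb⟩ := LocallyConstant.exists_nat_bound f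
  rcases hg with h | h
  · exact absurd h.symm hne
  change LocallyConstant X ℚ at f g
  change ∀ x, 0 < g x at h
  -- Bounding `1 / g` by `M` bounds `g` away from zero, so `N * M` copies of `g` dominate `|f| < N`.
  obtain ⟨M, -, hM⟩ := (g.map fun q => q⁻¹ : LocallyConstant X ℚ).exists_nat_bound
  have hM' : ∀ x, 1 < M * g x := by
    intro x
    have h1 : |(g x)⁻¹| < M := hM x
    rw [abs_of_pos (inv_pos.2 (h x)), inv_lt_iff_one_lt_mul₀ (h x)] at h1
    exact h1
  have hle : ∀ x, |f x| < (N * M : ℕ) * g x := by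
    intro x
    refine (hb x).trans ?_
    have : (0 : ℚ) < N := by exact_mod_cast hN
    push_cast
    nlinarith [hM' x]
  refine ⟨N * M, (strictGroup_le_iff _ _).2 (Or.inr fun x => ?_),
    (strictGroup_le_iff _ _).2 (Or.inr fun x => ?_)⟩
  · change -((N * M) • g x) < f x
    rw [nsmul_eq_mul]
    exact (abs_lt.1 (hle x)).1
  · change f x < (N * M) • g x
    rw [nsmul_eq_mul]
    exact (abs_lt.1 (hle x)).2

theorem strictGroup_unperforated : (strictGroup X).Unperforated := by
  intro f n hn h
  change LocallyConstant X ℚ at f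
  replace h := (strictGroup_le_iff _ _).1 h
  refine (strictGroup_le_iff _ _).2 ?_
  have hn' : (0 : ℚ) < n := by exact_mod_cast hn
  rcases h with h | h
  · left
    refine LocallyConstant.ext fun x => ?_
    have h1 : (0 : ℚ) = n • f x := DFunLike.congr_fun (F := LocallyConstant X ℚ) h x
    rw [nsmul_eq_mul] at h1
    exact ((mul_eq_zero.1 h1.symm).resolve_left hn'.ne').symm
  · right
    intro x
    have h1 : (0 : ℚ) < n • f x := h x
    rw [nsmul_eq_mul] at h1
    exact pos_of_mul_pos_right h1 hn'.le

theorem strictGroup_rieszInterpolation : (strictGroup X).RieszInterpolation := by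
  intro x₀ x₁ y₀ y₁ h₀₀ h₀₁ h₁₀ h₁₁
  change LocallyConstant X ℚ at x₀ x₁ y₀ y₁
  replace h₀₀ := (strictGroup_le_iff _ _).1 h₀₀
  replace h₀₁ := (strictGroup_le_iff _ _).1 h₀₁
  replace h₁₀ := (strictGroup_le_iff _ _).1 h₁₀
  replace h₁₁ := (strictGroup_le_iff _ _).1 h₁₁
  suffices h : ∃ z : LocallyConstant X ℚ, StrictLE x₀ z ∧ StrictLE x₁ z ∧
      StrictLE z y₀ ∧ StrictLE z y₁ by
    obtain ⟨z, h1, h2, h3, h4⟩ := h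
    exact ⟨z, (strictGroup_le_iff _ _).2 h1, (strictGroup_le_iff _ _).2 h2,
      (strictGroup_le_iff _ _).2 h3, (strictGroup_le_iff _ _).2 h4⟩
  have hrefl : ∀ f : LocallyConstant X ℚ, StrictLE f f := fun _ => Or.inl rfl
  rcases h₀₀ with rfl | h₀₀'
  · exact ⟨x₀, hrefl _, h₁₀, hrefl _, h₀₁⟩
  rcases h₀₁ with rfl | h₀₁'
  · exact ⟨x₀, hrefl _, h₁₁, Or.inr h₀₀', hrefl _⟩
  rcases h₁₀ with rfl | h₁₀'
  · exact ⟨x₁, Or.inr h₀₀', hrefl _, hrefl _, h₁₁⟩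
  rcases h₁₁ with rfl | h₁₁'
  · exact ⟨x₁, Or.inr h₀₁', hrefl _, Or.inr h₁₀', hrefl _⟩
  -- With all four inequalities strict everywhere, the midpoint of the gap interpolates strictly.
  have hz : IsLocallyConstant fun x => (max (x₀ x) (x₁ x) + min (y₀ x) (y₁ x)) / 2 :=
    (x₀.isLocallyConstant.comp₂ x₁.isLocallyConstant max).comp₂
      (y₀.isLocallyConstant.comp₂ y₁.isLocallyConstant min) fun a b => (a + b) / 2
  have hlt : ∀ x, max (x₀ x) (x₁ x) < min (y₀ x) (y₁ x) := fun x =>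
    max_lt (lt_min (h₀₀' x) (h₀₁' x)) (lt_min (h₁₀' x) (h₁₁' x))
  refine ⟨(⟨_, hz⟩ : LocallyConstant X ℚ), Or.inr fun x => ?_, Or.inr fun x => ?_,
    Or.inr fun x => ?_, Or.inr fun x => ?_⟩
  · exact (le_max_left _ (x₁ x)).trans_lt (left_lt_add_div_two.2 (hlt x))
  · exact (le_max_right (x₀ x) _).trans_lt (left_lt_add_div_two.2 (hlt x))
  · exact (add_div_two_lt_right.2 (hlt x)).trans_le (min_le_left _ (y₁ x))
  · exact (add_div_two_lt_right.2 (hlt x)).trans_le (min_le_right (y₀ x) _)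

/-- A function is determined by its finite set of pairs (value, clopen fiber), and there are only
countably many clopen sets. -/
theorem LocallyConstant.countable_of_secondCountable [T2Space X] [TotallyDisconnectedSpace X]
    [SecondCountableTopology X] : Countable (LocallyConstant X ℚ) := by
  have hC : Countable (TopologicalSpace.Clopens X) :=
    TopologicalSpace.Clopens.countable_iff_secondCountable.2 inferInstance
  let F : LocallyConstant X ℚ → Finset (ℚ × TopologicalSpace.Clopens X) := fun f =>
    f.range_finite.toFinset.map ⟨fun q => (q, ⟨f ⁻¹' {q}, f.isLocallyConstant.isClopen_fiber q⟩),
      fun q r h => (Prod.ext_iff.1 h).1⟩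
  refine Function.Injective.countable (f := F) fun f g hfg => LocallyConstant.ext fun x => ?_
  have h1 : (f x, (⟨f ⁻¹' {f x}, f.isLocallyConstant.isClopen_fiber _⟩ :
      TopologicalSpace.Clopens X)) ∈ F g := by
    rw [← hfg]
    exact Finset.mem_map.2 ⟨f x, by simp, rfl⟩
  obtain ⟨q, -, hq⟩ := Finset.mem_map.1 h1
  have hq1 : q = f x := (Prod.ext_iff.1 hq).1
  have hq2 : g ⁻¹' {q} = f ⁻¹' {f x} :=
    congrArg (fun U : TopologicalSpace.Clopens X => (U : Set X)) (Prod.ext_iff.1 hq).2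
  have hx : x ∈ g ⁻¹' {q} := hq2 ▸ (rfl : f x = f x)
  exact (hq1 ▸ (show g x = q from hx)).symm

end DimensionGroup

theorem Ordinal.countable_Iio_of_lt_omega_one {c : Ordinal.{0}} (hc : c < ω₁) :
    Countable (Set.Iio c) := by
  refine Cardinal.le_aleph0_iff_set_countable.1 ?_
  rw [Cardinal.mk_Iio_ordinal, Cardinal.lift_le_aleph0, ← Cardinal.lt_aleph_one_iff]
  exact Cardinal.lt_omega_iff_card_lt.1 hc

theorem ordinalGroup_isDimensionGroup {c : Ordinal.{0}} (hc : c < ω₁) :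
    (ordinalGroup c).IsDimensionGroup := by
  refine ⟨?_, strictGroup_unperforated, strictGroup_rieszInterpolation⟩
  have hcount : Countable (Set.Iic c) := by
    rw [Set.countable_coe_iff, ← Set.Iio_insert]
    exact Set.Countable.insert _ (Ordinal.countable_Iio_of_lt_omega_one hc)
  have : SecondCountableTopology (Set.Iic c) := inferInstance
  have : TotallyDisconnectedSpace (Set.Iic c) := inferInstance
  exact LocallyConstant.countable_of_secondCountable

/-- `ω₁` is closed under `ω ^ ·` and under countable suprema, hence under taking the next fixed
point and under limits of countable length. -/
theorem Ordinal.epsilon_lt_omega_one {a : Ordinal.{0}} (ha : a < ω₁) : epsilon a < ω₁ := by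
  have hnfp : ∀ b < ω₁, nfp (fun a : Ordinal.{0} => ω ^ a) b < ω₁ := by
    intro b hb
    rw [← iSup_iterate_eq_nfp]
    refine Ordinal.iSup_lt_omega_one fun n => ?_
    induction n with
    | zero => exact hb
    | succ n ih =>
      rw [Function.iterate_succ_apply']
      exact isPrincipal_opow_omega 1 omega0_lt_omega_one ih
  induction a using Ordinal.limitRecOn with
  | zero => rw [epsilon_zero_eq_nfp]; exact hnfp 0 (omega_pos 1)
  | add_one a ih =>
    rw [epsilon_eq_deriv, deriv_add_one, ← epsilon_eq_deriv]
    have h1 := ih ((lt_add_one a).trans ha)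
    exact hnfp _ ((Cardinal.isSuccLimit_omega 1).succ_lt h1)
  | limit a hl ih =>
    have : Countable {b // b < a} := countable_Iio_of_lt_omega_one ha
    rw [epsilon_eq_deriv, deriv_limit _ hl]
    refine Ordinal.iSup_lt_omega_one fun b => ?_
    rw [← epsilon_eq_deriv]
    exact ih b b.2 (b.2.trans ha)

theorem corollary3p9 :
    (∀ α : Ordinal.{0}, α < ω₁ →
      (ordinalGroup (ε_ α)).IsDimensionGroup ∧ (ordinalGroup (ε_ α)).IsSimple) ∧
    ∀ α β : Ordinal.{0}, α < β → β < ω₁ →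
      ¬ (ordinalGroup (ε_ α)).OrderIsomorphic (ordinalGroup (ε_ β)) ∧
      InfEquiv pointedLanguage (ε_ α)
        (ordinalGroup (ε_ α)).carrier (ordinalGroup (ε_ β)).carrier := by
  refine ⟨fun α hα => ⟨ordinalGroup_isDimensionGroup (Ordinal.epsilon_lt_omega_one hα),
    strictGroup_isSimple⟩, fun α β hαβ _ => ?_⟩
  have hlt : Ordinal.epsilon α < Ordinal.epsilon β := Ordinal.veblen_lt_veblen_iff_right.2 hαβ
  refine ⟨fun h => ?_, infEquiv_ordinalGroup (Ordinal.omega0_opow_epsilon α).le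
    ((Ordinal.omega0_opow_epsilon α).le.trans hlt.le)⟩
  rw [← Ordinal.omega0_opow_epsilon β] at h
  have h1 := h.opow_le
  rw [Ordinal.omega0_opow_epsilon, Ordinal.one_add_of_omega0_le (Ordinal.omega0_lt_epsilon α).le]
    at h1
  exact h1.not_gt hlt
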